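/- Identify the plane $\mathbb{R}^2$ with $\mathbb{C}$. Let $T_1,\dots,T_m\subset\mathbb{C}$ be compact sets with nonempty interior (prototiles), and for $1\le i,j\le m$ let $\Phi_{ij}$ be a finite set of Euclidean motions (reflections allowed). A \emph{tile} is a marked copy $T=g(T_i)$ of a prototile, given by its type $i$ and a motion $g$; if $g(z)=e^{i\alpha}z+t$ or $g(z)=e^{i\alpha}\bar z+t$ with $\alpha\in[0,2\pi)$, its orientation is $\alpha(T)=\alpha$. Put $\sigma(T_i)=\{\varphi(T_j) : 1\le j\le m,\ \varphi\in\Phi_{ij}\}$, and suppose that $\sigma$ is \emph{self-similar}: there is $\lambda>1$ such that, for each $i$, the union of the tiles in $\sigma(T_i)$ is $\lambda T_i$ and distinct tiles in $\sigma(T_i)$ have disjoint interiors. For a tile $T=A\,T_i+t$ with $A$ linear, put $\sigma(T)=\{A\,\varphi(T_j)+\lambda t : 1\le j\le m,\ \varphi\in\Phi_{ij}\}$, and extend $\sigma$ to collections of tiles by taking unions. Suppose that $\sigma$ is \emph{primitive}: some power $S^k$, $k\ge1$, of the matrix $S=(|\Phi_{ij}|)_{i,j}$ has only positive entries. Let $X_\sigma$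 be the set of all tilings $\mathcal{T}$ of the plane (collections of tiles that cover the plane and have pairwise disjoint interiors) such that each finite subset of $\mathcal{T}$ is congruent to a subset of some $\sigma^n(T_i)$. A tiling $\mathcal{T}\in X_\sigma$ is \emph{pinwheel-like} if $\{\alpha(T):T\in\mathcal{T}\}$ is infinite. It has \emph{statistical circular symmetry} if the following two conditions hold for all $0\le x<y<2\pi$. (a) Let $(\tau_j)_{j\ge1}$ be any enumeration without repetition of the tiles of $\mathcal{T}$ for which the set $N$ of all $n$ such that $\{\tau_1,\dots,\tau_n\}$ is congruent to some supertile $\sigma^k(T_i)$ is infinite. Then $$\lim_{n\to\infty,\ n\in N}\ \frac1n\,\bigl|\{\,1\le j\le n : \alpha(\tau_j)\in[x,y]\,\}\bigr|=\frac{y-x}{2\pi}.$$ (b) Let $(\tau_j)_{j\ge1}$ be any enumeration without repetition of the tiles of $\mathcal{T}$ by nondecreasing distance from the origin. Then $$\lim_{n\to\infty}\ \frac1n\,\bigl|\{\,1\le j\le n : \alpha(\tau_j)\in[x,y]\,\}\bigr|=\frac{y-x}{2\pi}.$$ Theorem. Let $\sigma$ be a primitive self-similar substitution in the plane as above, and let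 $\mathcal{T}\in X_\sigma$ be pinwheel-like. Then $\mathcal{T}$ has statistical circular symmetry. Consequently every tiling in $X_\sigma$ has statistical circular symmetry. -/

import Mathlib

open Set Filter Topology
open scoped Pointwise

noncomputable section

namespace PlaneTiling

/-- The Euclidean group `E(2)` of the plane `ℂ`: all maps `z ↦ a z + t` and `z ↦ a (conj z) + t`
with `|a| = 1` (rotations, reflections, translations and their composites). -/
abbrev Motion : Type := ℂ ≃ᵃⁱ[ℝ] ℂ

/-- A marked tile: a congruent copy `pos (T_kind)` of the prototile with index `kind`. Recording the
motion and not only the point set marks the tile, so that type and orientation are well defined also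
when a prototile has symmetries or two prototiles are congruent. -/
@[ext]
structure Tile (ι : Type*) where
  kind : ι
  pos : Motion

variable {ι : Type*}

/-- The image of a tile under a motion. -/
def Tile.move (g : Motion) (T : Tile ι) : Tile ι := ⟨T.kind, g * T.pos⟩

/-- The orientation `α(T) ∈ [0, 2π)`: it is `α` for `T = R_α T_i + t`, and also for the copy
`T = R_α (conj T_i) + t` of the mirror image of the prototile, as in both cases the linear part maps
`1` to `exp (i α)`. -/
def Tile.angle (T : Tile ι) : ℝ :=
  toIcoMod Real.two_pi_pos 0 (Complex.arg (T.pos.linearIsometryEquiv 1))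

/-- For `g z = A z + t` with `A` linear, the motion `z ↦ A z + c t`. -/
def Motion.inflate (c : ℝ) (g : Motion) : Motion :=
  AffineIsometryEquiv.constVAdd ℝ ℂ (c • g 0) * g.linearIsometryEquiv.toAffineIsometryEquiv

/-- The data of a substitution in the plane: prototiles `T_i`, finite sets `Φ_ij` of motions, and
the factor `λ` by which the substitution stretches translations. -/
structure Substitution (ι : Type*) where
  proto : ι → Set ℂ
  isCompact_proto : ∀ i, IsCompact (proto i)
  nonempty_interior_proto : ∀ i, (interior (proto i)).Nonempty
  maps : ι → ι → Finset Motion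
  factor : ℝ

namespace Substitution

variable (σ : Substitution ι)

/-- The point set covered by a tile. -/
def support (T : Tile ι) : Set ℂ := T.pos '' σ.proto T.kind

/-- The tiles overlap at most in boundary points. -/
def IsPacking (P : Set (Tile ι)) : Prop :=
  P.Pairwise fun T T' => Disjoint (interior (σ.support T)) (interior (σ.support T'))

/-- The prototile `T_i` as a tile. -/
def protoTile (i : ι) : Tile ι := ⟨i, 1⟩

/-- `σ` on a tile: for `T = A T_i + t`, the tiles `A (φ T_j) + λ t` with `φ ∈ Φ_ij`. -/
def substTile (T : Tile ι) : Set (Tile ι) :=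
  {T' | ∃ φ ∈ σ.maps T.kind T'.kind, T'.pos = Motion.inflate σ.factor T.pos * φ}

/-- `σ` on a collection of tiles. -/
def subst (P : Set (Tile ι)) : Set (Tile ι) := ⋃ T ∈ P, σ.substTile T

/-- The supertile `σ^n(T_i)`. -/
def supertile (n : ℕ) (i : ι) : Set (Tile ι) := σ.subst^[n] {protoTile i}

/-- Self-similarity: `λ > 1`, and `σ(T_i)` is a dissection of `λ T_i` for every `i`. -/
structure IsSelfSimilar : Prop where
  one_lt_factor : 1 < σ.factor
  smul_proto_eq : ∀ i, σ.factor • σ.proto i = ⋃ T ∈ σ.substTile (protoTile i), σ.support T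
  isPacking : ∀ i, σ.IsPacking (σ.substTile (protoTile i))

/-- The substitution matrix `(|Φ_ij|)`. -/
def matrix : Matrix ι ι ℤ := Matrix.of fun i j => ((σ.maps i j).card : ℤ)

/-- A tiling: a packing of the plane which covers the plane. -/
structure IsTiling (𝒯 : Set (Tile ι)) : Prop where
  isPacking : σ.IsPacking 𝒯
  covers : ⋃ T ∈ 𝒯, σ.support T = univ

/-- The tiling space `X_σ`: the tilings all of whose patches (finite subsets) are congruent to
patches of supertiles `σ^n(T_i)`. -/
def tilingSpace : Set (Set (Tile ι)) :=
  {𝒯 | σ.IsTiling 𝒯 ∧ ∀ P ⊆ 𝒯, P.Finite →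
    ∃ (n : ℕ) (i : ι) (g : Motion), Tile.move g '' P ⊆ σ.supertile n i}

/-- Congruent to a supertile `σ^k(T_i)`. -/
def IsSupertile (P : Set (Tile ι)) : Prop :=
  ∃ (k : ℕ) (i : ι) (g : Motion), P = Tile.move g '' σ.supertile k i

/-- The sequence `s` enumerates the tiles of `𝒯` without repetition, and arbitrarily long initial
segments of it consist of exactly the tiles of some supertile. -/
def IsOrderedAlongSupertiles (𝒯 : Set (Tile ι)) (s : ℕ → Tile ι) : Prop :=
  BijOn s univ 𝒯 ∧ ∀ n, ∃ l ≥ n, σ.IsSupertile (s '' Iio l)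

/-- The sequence `s` enumerates the tiles of `𝒯` without repetition, by nondecreasing distance from
the origin. -/
def IsOrderedByDistance (𝒯 : Set (Tile ι)) (s : ℕ → Tile ι) : Prop :=
  BijOn s univ 𝒯 ∧ Monotone fun j => Metric.infDist 0 (σ.support (s j))

end Substitution

/-- `𝒯` contains tiles in infinitely many orientations. -/
def IsPinwheelLike (𝒯 : Set (Tile ι)) : Prop := (Tile.angle '' 𝒯).Infinite

open Classical in
/-- The proportion of the orientations in `[x, y]` among the first `n` tiles of a sequence. -/
def angleFrequency (s : ℕ → Tile ι) (x y : ℝ) (n : ℕ) : ℝ :=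
  (((Finset.range n).filter fun j => (s j).angle ∈ Icc x y).card : ℝ) / n

/-- The orientations of the tiles of the sequence are uniformly distributed in `[0, 2π)`, where the
number `n` of tiles over which one averages tends to infinity within the set `N`. -/
def UniformlyDistributedAlong (N : Set ℕ) (s : ℕ → Tile ι) : Prop :=
  ∀ x y : ℝ, 0 ≤ x → x < y → y < 2 * Real.pi →
    Tendsto (angleFrequency s x y) (atTop ⊓ 𝓟 N) (𝓝 ((y - x) / (2 * Real.pi)))

/-- Statistical circular symmetry of a tiling: the orientations are uniformly distributed for every
ordering of the tiles along supertiles, with averages over these supertiles, and for every ordering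
of the tiles by distance from the origin, with averages over all initial segments. (The second
ordering is available for every tiling in the tiling space, also for those which are not a union of
an increasing sequence of supertiles.) -/
structure Substitution.HasStatisticalCircularSymmetry (σ : Substitution ι)
    (𝒯 : Set (Tile ι)) : Prop where
  along_supertiles : ∀ s, σ.IsOrderedAlongSupertiles 𝒯 s →
    UniformlyDistributedAlong {n | σ.IsSupertile (s '' Iio n)} s
  by_distance : ∀ s, σ.IsOrderedByDistance 𝒯 s → UniformlyDistributedAlong univ s

end PlaneTiling

end

/-!
A pinwheel-like tiling contains, for every `k ≠ 0`, two tiles of the same kind that differ by a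
rotation by some `u` with `u ^ k ≠ 1`. By primitivity, such a pair occurs in all supertiles of some
level `n`. In the exponential sum of `exp (i k α)` over a supertile of level `m + n`, split into
supertiles of level `m`, the two terms that come from the pair cancel in part, so that every `n`
further levels shrink the mean by a fixed factor: the means over supertiles of level `K` tend to
zero, uniformly, as `K → ∞`. A disc of radius `R` consists of complete supertiles of level `K` and a
boundary layer of only `O(R)` of its `≍ R²` tiles, so the means over discs tend to zero as well.
Weyl's criterion turns these estimates into the uniform distribution of the orientations.
All tilings in the tiling space share the same supertiles, so one pinwheel-like tiling suffices.
-/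

open MeasureTheory

noncomputable section

namespace PlaneTiling

variable {ι : Type*}

/-! ### Motions and tiles -/

namespace Motion

theorem apply_eq_linear_add (g : Motion) (z : ℂ) : g z = g.linearIsometryEquiv z + g 0 := by
  simpa using g.map_vadd (0 : ℂ) z

theorem linear_mul (g h : Motion) :
    (g * h).linearIsometryEquiv = g.linearIsometryEquiv * h.linearIsometryEquiv := rfl

theorem linear_inv (g : Motion) : g⁻¹.linearIsometryEquiv = g.linearIsometryEquiv⁻¹ := rfl

theorem inflate_apply (c : ℝ) (g : Motion) (z : ℂ) :
    inflate c g z = g.linearIsometryEquiv z + c • g 0 := by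
  simp [inflate, add_comm]

@[simp]
theorem linear_inflate (c : ℝ) (g : Motion) :
    (inflate c g).linearIsometryEquiv = g.linearIsometryEquiv := by
  ext z
  have h := apply_eq_linear_add (inflate c g) z
  rw [inflate_apply, inflate_apply] at h
  simpa using h.symm

theorem inflate_apply_smul (c : ℝ) (g : Motion) (z : ℂ) : inflate c g (c • z) = c • g z := by
  rw [inflate_apply, apply_eq_linear_add g z, map_smul, smul_add]

theorem inflate_mul (c : ℝ) (g h : Motion) : inflate c (g * h) = inflate c g * inflate c h := by
  ext z
  simp only [AffineIsometryEquiv.coe_mul, Function.comp_apply, inflate_apply, linear_mul,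
    LinearIsometryEquiv.coe_mul, apply_eq_linear_add g (h 0), map_add, map_smul, smul_add]
  ring

theorem inflate_one (g : Motion) : inflate 1 g = g := by
  ext z
  rw [inflate_apply, one_smul, ← apply_eq_linear_add]

theorem inflate_inflate (a b : ℝ) (g : Motion) : inflate a (inflate b g) = inflate (a * b) g := by
  ext z
  simp [inflate_apply, mul_smul]

theorem iterate_inflate (c : ℝ) (n : ℕ) (g : Motion) :
    (inflate c)^[n] g = inflate (c ^ n) g := by
  induction n with
  | zero => rw [pow_zero, inflate_one, Function.iterate_zero_apply]
  | succ n ih => rw [Function.iterate_succ_apply', ih, inflate_inflate, pow_succ']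

theorem inflate_surjective {c : ℝ} (hc : c ≠ 0) : Function.Surjective (inflate c) := fun g =>
  ⟨inflate c⁻¹ g, by rw [inflate_inflate, mul_inv_cancel₀ hc, inflate_one]⟩

theorem measurePreserving (g : Motion) : MeasurePreserving g (volume : Measure ℂ) volume := by
  rw [show ⇑g = (· + g 0) ∘ g.linearIsometryEquiv from funext g.apply_eq_linear_add]
  exact (measurePreserving_add_right _ _).comp g.linearIsometryEquiv.measurePreserving

theorem volume_real_image (g : Motion) (s : Set ℂ) : volume.real (g '' s) = volume.real s := by
  have h := g.measurePreserving.measure_preimage_equiv (f := g.toHomeomorph.toMeasurableEquiv)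
    (g '' s)
  rw [measureReal_def, measureReal_def, ← h]
  exact congrArg (fun t => (volume t).toReal) (preimage_image_eq s g.injective)

theorem image_interior (g : Motion) (s : Set ℂ) : g '' interior s = interior (g '' s) :=
  g.toHomeomorph.image_interior s

end Motion

namespace Tile

@[simp] theorem kind_move (g : Motion) (T : Tile ι) : (T.move g).kind = T.kind := rfl

@[simp] theorem pos_move (g : Motion) (T : Tile ι) : (T.move g).pos = g * T.pos := rfl

theorem move_move (g h : Motion) (T : Tile ι) : (T.move h).move g = T.move (g * h) := by
  simp [Tile.ext_iff, mul_assoc]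

@[simp] theorem move_one (T : Tile ι) : T.move 1 = T := by simp [Tile.ext_iff]

theorem move_injective (g : Motion) : Function.Injective (move g : Tile ι → Tile ι) := by
  intro S T h
  simpa [Tile.ext_iff] using h

theorem move_pos_mul_inv_pos {S T : Tile ι} (h : S.kind = T.kind) :
    S.move (T.pos * S.pos⁻¹) = T :=
  Tile.ext h (by simp)

theorem move_pos_protoTile (T : Tile ι) :
    (Substitution.protoTile T.kind).move T.pos = T := by
  simp [Tile.ext_iff, Substitution.protoTile]

end Tile

theorem exists_pos_forall_le_of_finite {κ : Type*} [Finite κ] (f : κ → ℝ) :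
    ∃ C > 0, ∀ i, f i ≤ C := by
  obtain ⟨C, hC⟩ := (finite_range f).bddAbove
  exact ⟨max C 1, by positivity, fun i => le_max_of_le_left (hC (mem_range_self i))⟩

namespace Substitution

variable (σ : Substitution ι)

theorem support_move (g : Motion) (T : Tile ι) : σ.support (T.move g) = g '' σ.support T := by
  simp [support, image_image]

theorem isCompact_support (T : Tile ι) : IsCompact (σ.support T) :=
  (σ.isCompact_proto _).image T.pos.continuous

theorem nonempty_interior_support (T : Tile ι) : (interior (σ.support T)).Nonempty := by
  rw [support, ← Motion.image_interior]
  exact (σ.nonempty_interior_proto _).image _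

theorem nonempty_support (T : Tile ι) : (σ.support T).Nonempty :=
  (σ.nonempty_interior_support T).mono interior_subset

theorem volume_interior_support_ne_top (T : Tile ι) : volume (interior (σ.support T)) ≠ ⊤ :=
  measure_ne_top_of_subset interior_subset (σ.isCompact_support T).measure_ne_top

theorem exists_le_volume_interior_support [Finite ι] :
    ∃ b > 0, ∀ T : Tile ι, b ≤ volume.real (interior (σ.support T)) := by
  obtain ⟨b, hb, hbσ⟩ := Pi.exists_forall_pos_add_lt
    (x := 0) (y := fun i => volume.real (interior (σ.proto i))) fun i =>
      ENNReal.toReal_pos (isOpen_interior.measure_pos _ (σ.nonempty_interior_proto i)).ne'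
        (measure_ne_top_of_subset interior_subset (σ.isCompact_proto i).measure_ne_top)
  refine ⟨b, hb, fun T => ?_⟩
  rw [support, ← Motion.image_interior, Motion.volume_real_image]
  simpa only [Pi.zero_apply, zero_add] using (hbσ T.kind).le

theorem exists_volume_support_le [Finite ι] :
    ∃ a > 0, ∀ T : Tile ι, volume.real (σ.support T) ≤ a := by
  obtain ⟨a, ha, haσ⟩ := exists_pos_forall_le_of_finite fun i => volume.real (σ.proto i)
  refine ⟨a, ha, fun T => ?_⟩
  rw [support, Motion.volume_real_image]
  exact haσ T.kind

theorem exists_diam_support_le [Finite ι] :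
    ∃ d > 0, ∀ T : Tile ι, Metric.diam (σ.support T) ≤ d := by
  obtain ⟨d, hd, hdσ⟩ := exists_pos_forall_le_of_finite fun i => Metric.diam (σ.proto i)
  exact ⟨d, hd, fun T => (T.pos.isometry.diam_image _).trans_le (hdσ T.kind)⟩

/-! ### Iterated substitution -/

theorem substTile_move (g : Motion) (T : Tile ι) :
    σ.substTile (T.move g) = Tile.move (Motion.inflate σ.factor g) '' σ.substTile T := by
  ext S
  constructor
  · rintro ⟨φ, hφ, h⟩
    exact ⟨⟨S.kind, Motion.inflate σ.factor T.pos * φ⟩, ⟨φ, hφ, rfl⟩,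
      Tile.ext rfl (by simp [h, Motion.inflate_mul, mul_assoc])⟩
  · rintro ⟨S, ⟨φ, hφ, h⟩, rfl⟩
    exact ⟨φ, hφ, by simp [h, Motion.inflate_mul, mul_assoc]⟩

theorem subst_move (g : Motion) (P : Set (Tile ι)) :
    σ.subst (Tile.move g '' P) = Tile.move (Motion.inflate σ.factor g) '' σ.subst P := by
  simp [subst, image_iUnion₂, substTile_move]

theorem iterate_subst_move (n : ℕ) (g : Motion) (P : Set (Tile ι)) :
    σ.subst^[n] (Tile.move g '' P) =
      Tile.move (Motion.inflate (σ.factor ^ n) g) '' σ.subst^[n] P := by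
  rw [← Motion.iterate_inflate]
  induction n with
  | zero => rfl
  | succ n ih => simp only [Function.iterate_succ_apply', ih, subst_move]

theorem iterate_subst_iUnion {κ : Sort*} (n : ℕ) (P : κ → Set (Tile ι)) :
    σ.subst^[n] (⋃ i, P i) = ⋃ i, σ.subst^[n] (P i) := by
  induction n with
  | zero => rfl
  | succ n ih => simp only [Function.iterate_succ_apply', ih, subst, biUnion_iUnion]

theorem iterate_subst_eq_biUnion (n : ℕ) (P : Set (Tile ι)) :
    σ.subst^[n] P = ⋃ T ∈ P, σ.subst^[n] {T} := by
  conv_lhs => rw [← biUnion_of_singleton P]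
  simp only [iterate_subst_iUnion]

theorem finite_substTile [Finite ι] (T : Tile ι) : (σ.substTile T).Finite := by
  refine (finite_iUnion fun j => ((σ.maps T.kind j).finite_toSet.image
    fun φ => (⟨j, Motion.inflate σ.factor T.pos * φ⟩ : Tile ι))).subset ?_
  rintro S ⟨φ, hφ, h⟩
  exact mem_iUnion.2 ⟨S.kind, φ, hφ, Tile.ext rfl h.symm⟩

theorem finite_iterate_subst [Finite ι] (n : ℕ) {P : Set (Tile ι)} (hP : P.Finite) :
    (σ.subst^[n] P).Finite := by
  induction n with
  | zero => exact hP
  | succ n ih =>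
    rw [Function.iterate_succ_apply']
    exact ih.biUnion fun T _ => σ.finite_substTile T

section supertileOf

variable [Finite ι]

/-- The supertile `σ^n(T)` of an arbitrary tile `T`, as a finite set over which one can sum. -/
def supertileOf (n : ℕ) (T : Tile ι) : Finset (Tile ι) :=
  (σ.finite_iterate_subst n (finite_singleton T)).toFinset

@[simp]
theorem coe_supertileOf (n : ℕ) (T : Tile ι) :
    (σ.supertileOf n T : Set (Tile ι)) = σ.subst^[n] {T} := by
  simp [supertileOf]

theorem mem_supertileOf {n : ℕ} {S T : Tile ι} :
    S ∈ σ.supertileOf n T ↔ S ∈ σ.subst^[n] {T} := by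
  simp [supertileOf]

theorem supertileOf_zero (T : Tile ι) : σ.supertileOf 0 T = {T} := by
  simp [← Finset.coe_inj]

theorem supertileOf_add [DecidableEq (Tile ι)] (m n : ℕ) (T : Tile ι) :
    σ.supertileOf (m + n) T = (σ.supertileOf n T).biUnion (σ.supertileOf m) := by
  rw [← Finset.coe_inj, coe_supertileOf, Finset.coe_biUnion, Function.iterate_add_apply,
    iterate_subst_eq_biUnion]
  simp

theorem supertileOf_move [DecidableEq (Tile ι)] (n : ℕ) (g : Motion) (T : Tile ι) :
    σ.supertileOf n (T.move g) =
      (σ.supertileOf n T).image (Tile.move (Motion.inflate (σ.factor ^ n) g)) := by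
  rw [← Finset.coe_inj, coe_supertileOf, Finset.coe_image, coe_supertileOf, ← iterate_subst_move,
    image_singleton]

theorem sum_supertileOf_move {M : Type*} [AddCommMonoid M] (n : ℕ) (g : Motion) (T : Tile ι)
    (f : Tile ι → M) :
    ∑ S ∈ σ.supertileOf n (T.move g), f S =
      ∑ S ∈ σ.supertileOf n T, f (S.move (Motion.inflate (σ.factor ^ n) g)) := by
  classical
  rw [supertileOf_move, Finset.sum_image (Tile.move_injective _).injOn]

theorem card_supertileOf (n : ℕ) (T : Tile ι) :
    (σ.supertileOf n T).card = (σ.supertileOf n (protoTile T.kind)).card := by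
  conv_lhs => rw [← T.move_pos_protoTile, Finset.card_eq_sum_ones, sum_supertileOf_move]
  rw [← Finset.card_eq_sum_ones]

theorem exists_card_supertileOf_le (N : ℕ) :
    ∃ C : ℕ, ∀ n ≤ N, ∀ T, (σ.supertileOf n T).card ≤ C := by
  obtain ⟨C, hC⟩ := (finite_range fun p : Fin (N + 1) × ι =>
    (σ.supertileOf p.1 (protoTile p.2)).card).bddAbove
  refine ⟨C, fun n hn T => ?_⟩
  rw [card_supertileOf]
  exact hC ⟨(⟨n, Nat.lt_succ_of_le hn⟩, T.kind), rfl⟩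

end supertileOf

theorem IsSupertile.exists_eq_supertileOf [Finite ι] {σ : Substitution ι} (h0 : σ.factor ≠ 0)
    {P : Set (Tile ι)} (hP : σ.IsSupertile P) : ∃ n T, P = σ.supertileOf n T := by
  obtain ⟨n, i, g, rfl⟩ := hP
  obtain ⟨h, rfl⟩ := Motion.inflate_surjective (pow_ne_zero n h0) g
  refine ⟨n, (protoTile i).move h, ?_⟩
  rw [coe_supertileOf, ← image_singleton, iterate_subst_move, supertile]

/-! ### Consequences of self-similarity -/

namespace IsSelfSimilar

variable {σ : Substitution ι} (hσ : σ.IsSelfSimilar)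

include hσ

theorem factor_pos : 0 < σ.factor := one_pos.trans hσ.one_lt_factor

theorem factor_ne_zero : σ.factor ≠ 0 := hσ.factor_pos.ne'

theorem biUnion_support_substTile (T : Tile ι) :
    ⋃ S ∈ σ.substTile T, σ.support S = σ.factor • σ.support T := by
  conv_lhs => rw [← T.move_pos_protoTile, substTile_move, biUnion_image]
  simp_rw [support_move, ← image_iUnion₂]
  rw [← hσ.smul_proto_eq, support]
  ext z
  simp only [mem_image, mem_smul_set, exists_exists_and_eq_and, Motion.inflate_apply_smul]

theorem isPacking_substTile (T : Tile ι) : σ.IsPacking (σ.substTile T) := by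
  rw [← T.move_pos_protoTile, substTile_move]
  rintro _ ⟨S, hS, rfl⟩ _ ⟨S', hS', rfl⟩ hne
  rw [support_move, support_move, ← Motion.image_interior, ← Motion.image_interior,
    disjoint_image_iff (AffineIsometryEquiv.injective _)]
  exact hσ.isPacking T.kind hS hS' (ne_of_apply_ne _ hne)

theorem biUnion_support_iterate_subst (n : ℕ) (P : Set (Tile ι)) :
    ⋃ S ∈ σ.subst^[n] P, σ.support S = σ.factor ^ n • ⋃ T ∈ P, σ.support T := by
  induction n with
  | zero => simp
  | succ n ih =>
    rw [Function.iterate_succ_apply', pow_succ', ← smul_smul, ← ih, smul_set_iUnion₂, subst]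
    simp only [biUnion_iUnion, hσ.biUnion_support_substTile]

theorem support_subset_of_mem_iterate_subst {n : ℕ} {S T : Tile ι} (hS : S ∈ σ.subst^[n] {T}) :
    σ.support S ⊆ σ.factor ^ n • σ.support T := by
  have h := hσ.biUnion_support_iterate_subst n {T}
  rw [biUnion_singleton] at h
  exact h ▸ subset_biUnion_of_mem (u := σ.support) hS

theorem disjoint_interior_of_mem_iterate_subst {n : ℕ} {S S' T T' : Tile ι}
    (hS : S ∈ σ.subst^[n] {T}) (hS' : S' ∈ σ.subst^[n] {T'})
    (h : Disjoint (interior (σ.support T)) (interior (σ.support T'))) :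
    Disjoint (interior (σ.support S)) (interior (σ.support S')) := by
  have hn : σ.factor ^ n ≠ 0 := pow_ne_zero n hσ.factor_ne_zero
  have interior_subset_smul {A B : Tile ι} (hA : A ∈ σ.subst^[n] {B}) :
      interior (σ.support A) ⊆ σ.factor ^ n • interior (σ.support B) := by
    rw [← interior_smul₀ hn]
    exact interior_mono (hσ.support_subset_of_mem_iterate_subst hA)
  exact ((disjoint_image_iff (smul_right_injective ℂ hn)).2 h).mono
    (interior_subset_smul hS) (interior_subset_smul hS')

theorem isPacking_subst {P : Set (Tile ι)} (hP : σ.IsPacking P) : σ.IsPacking (σ.subst P) := by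
  intro S hS S' hS' hne
  obtain ⟨T, hT, hS⟩ := mem_iUnion₂.1 hS
  obtain ⟨T', hT', hS'⟩ := mem_iUnion₂.1 hS'
  rcases eq_or_ne T T' with rfl | hTT
  · exact hσ.isPacking_substTile T hS hS' hne
  · exact hσ.disjoint_interior_of_mem_iterate_subst (n := 1) (by simpa [subst] using hS)
      (by simpa [subst] using hS') (hP hT hT' hTT)

theorem isPacking_iterate_subst (n : ℕ) {P : Set (Tile ι)} (hP : σ.IsPacking P) :
    σ.IsPacking (σ.subst^[n] P) := by
  induction n with
  | zero => exact hP
  | succ n ih =>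
    rw [Function.iterate_succ_apply']
    exact hσ.isPacking_subst ih

variable [Finite ι]

theorem isPacking_supertileOf (n : ℕ) (T : Tile ι) : σ.IsPacking (σ.supertileOf n T) := by
  rw [coe_supertileOf]
  exact hσ.isPacking_iterate_subst n (pairwise_singleton _ _)

theorem disjoint_supertileOf (n : ℕ) {S T : Tile ι}
    (h : Disjoint (interior (σ.support S)) (interior (σ.support T))) :
    Disjoint (σ.supertileOf n S) (σ.supertileOf n T) := by
  rw [Finset.disjoint_left]
  intro A hS hT
  rw [mem_supertileOf] at hS hT
  exact (σ.nonempty_interior_support A).ne_empty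
    (disjoint_self.1 (hσ.disjoint_interior_of_mem_iterate_subst hS hT h))

theorem sum_supertileOf_add {M : Type*} [AddCommMonoid M] (m n : ℕ) (T : Tile ι)
    (f : Tile ι → M) :
    ∑ S ∈ σ.supertileOf (m + n) T, f S =
      ∑ A ∈ σ.supertileOf n T, ∑ S ∈ σ.supertileOf m A, f S := by
  classical
  rw [supertileOf_add, Finset.sum_biUnion]
  exact fun A hA B hB hne => hσ.disjoint_supertileOf m (hσ.isPacking_supertileOf n T hA hB hne)

theorem card_supertileOf_add (m n : ℕ) (T : Tile ι) :
    (σ.supertileOf (m + n) T).card =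
      ∑ A ∈ σ.supertileOf n T, (σ.supertileOf m A).card := by
  simp only [Finset.card_eq_sum_ones, hσ.sum_supertileOf_add]

end IsSelfSimilar

end Substitution

/-! ### Orientations -/

namespace Tile

/-- The unit complex number `exp (i α(T))`, see `Tile.exp_angle_mul_I`. -/
def direction (T : Tile ι) : ℂ := T.pos.linearIsometryEquiv 1

@[simp]
theorem norm_direction (T : Tile ι) : ‖T.direction‖ = 1 := by
  simp [direction]

theorem direction_ne_zero (T : Tile ι) : T.direction ≠ 0 := by
  simp [← norm_ne_zero_iff]

theorem direction_move {g : Motion} {u : Circle} (hg : g.linearIsometryEquiv = rotation u)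
    (T : Tile ι) : (T.move g).direction = u * T.direction := by
  rw [direction, pos_move, Motion.linear_mul, hg, LinearIsometryEquiv.coe_mul, Function.comp_apply,
    rotation_apply, direction]

theorem move_ne_self {g : Motion} {u : Circle} (hg : g.linearIsometryEquiv = rotation u)
    (hu : u ≠ 1) (T : Tile ι) : T.move g ≠ T := by
  intro h
  have hd := direction_move hg T
  rw [h, right_eq_mul₀ T.direction_ne_zero] at hd
  exact hu (Circle.ext hd)

theorem angle_mem_Ico (T : Tile ι) : T.angle ∈ Ico 0 (2 * Real.pi) := by
  have h := toIcoMod_mem_Ico Real.two_pi_pos 0 (Complex.arg T.direction)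
  rwa [zero_add] at h

theorem exp_angle_mul_I (T : Tile ι) : Complex.exp (T.angle * Complex.I) = T.direction := by
  have h : T.angle = Complex.arg T.direction
      - toIcoDiv Real.two_pi_pos 0 (Complex.arg T.direction) * (2 * Real.pi) := by
    rw [← zsmul_eq_mul]
    rfl
  have h' : Complex.exp (Complex.arg T.direction * Complex.I) = T.direction := by
    simpa using Complex.norm_mul_exp_arg_mul_I T.direction
  rw [h]
  push_cast
  rw [sub_mul, Complex.exp_sub, h', mul_assoc _ (2 * _ : ℂ), Complex.exp_int_mul_two_pi_mul_I,
    div_one]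

end Tile

theorem index_range_rotation : rotation.range.index = 2 := by
  refine Subgroup.index_eq_two_iff.2 ⟨Complex.conjLIE, fun A => ?_⟩
  have conjLIE_notMem : Complex.conjLIE ∉ rotation.range := fun ⟨u, hu⟩ =>
    rotation_ne_conjLIE u hu
  have conjLIE_mul_self : Complex.conjLIE * Complex.conjLIE = 1 := by
    ext z
    simp
  have rotation_mem (u : Circle) : rotation u ∈ rotation.range := ⟨u, rfl⟩
  obtain ⟨u, rfl | rfl⟩ := linear_isometry_complex A
  · exact Or.inr ⟨rotation_mem u, by rwa [Subgroup.mul_mem_cancel_left _ (rotation_mem u)]⟩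
  · left
    rw [show Complex.conjLIE.trans (rotation u) = rotation u * Complex.conjLIE from rfl, mul_assoc,
      conjLIE_mul_self, mul_one, Subgroup.mul_mem_cancel_left _ (rotation_mem u)]
    exact ⟨rotation_mem u, conjLIE_notMem⟩

theorem conj_rotation_eq (A : ℂ ≃ₗᵢ[ℝ] ℂ) (u : Circle) :
    A * rotation u * A⁻¹ = rotation u ∨ A * rotation u * A⁻¹ = rotation u⁻¹ := by
  simp only [mul_inv_eq_iff_eq_mul]
  obtain ⟨a, rfl | rfl⟩ := linear_isometry_complex A
  · left
    rw [← map_mul, ← map_mul, mul_comm]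
  · right
    ext z
    simp only [LinearIsometryEquiv.coe_mul, Function.comp_apply, LinearIsometryEquiv.trans_apply,
      Complex.conjLIE_apply, rotation_apply, map_mul, Circle.coe_inv_eq_conj]
    ring

theorem finite_setOf_zpow_eq {K : Type*} [Field K] {k : ℤ} (hk : k ≠ 0) (w : K) :
    {z : K | z ^ k = w}.Finite := by
  classical
  refine ((Polynomial.nthRoots k.natAbs w).toFinset.finite_toSet.union
    (Polynomial.nthRoots k.natAbs w⁻¹).toFinset.finite_toSet).subset fun z hz => ?_
  simp only [mem_union, Finset.mem_coe, Multiset.mem_toFinset,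
    Polynomial.mem_nthRoots (Int.natAbs_pos.2 hk), ← hz.out, ← zpow_natCast]
  rcases Int.natAbs_eq k with h | h
  · exact Or.inl (by rw [← h])
  · exact Or.inr (by rw [← zpow_neg, h, neg_neg, Int.natAbs_neg, Int.natAbs_natCast])

theorem exists_ne_of_infinite_image {α β γ : Type*} [Finite γ] {s : Set α} {f : α → β}
    (h : (f '' s).Infinite) (c : α → γ) : ∃ x ∈ s, ∃ y ∈ s, c x = c y ∧ f x ≠ f y := by
  obtain ⟨t, hts, ht⟩ := s.exists_subset_bijOn f
  have htinf : t.Infinite := Infinite.of_image f (ht.image_eq ▸ h)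
  obtain ⟨x, hx, y, hy, hxy, hc⟩ := htinf.exists_ne_map_eq_of_mapsTo (mapsTo_univ c t) finite_univ
  exact ⟨x, hts hx, y, hts hy, hc, ht.injOn.ne hx hy hxy⟩

/-- The patch contains two tiles of the same kind which differ by a motion that rotates by `u`. -/
def RotatedPair (u : Circle) (P : Set (Tile ι)) : Prop :=
  ∃ S ∈ P, ∃ h : Motion, h.linearIsometryEquiv = rotation u ∧ S.move h ∈ P

namespace RotatedPair

variable {u : Circle} {P Q : Set (Tile ι)}

theorem mono (h : RotatedPair u P) (hPQ : P ⊆ Q) : RotatedPair u Q := by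
  obtain ⟨S, hS, g, hg, hS'⟩ := h
  exact ⟨S, hPQ hS, g, hg, hPQ hS'⟩

theorem inv (h : RotatedPair u P) : RotatedPair u⁻¹ P := by
  obtain ⟨S, hS, g, hg, hS'⟩ := h
  exact ⟨_, hS', g⁻¹, by rw [Motion.linear_inv, hg, map_inv],
    by rwa [Tile.move_move, inv_mul_cancel, Tile.move_one]⟩

theorem move (h : RotatedPair u P) (g : Motion) : RotatedPair u (Tile.move g '' P) := by
  obtain ⟨S, hS, f, hf, hS'⟩ := h
  have conj_pair {v : Circle} (hv : (g * f * g⁻¹).linearIsometryEquiv = rotation v) :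
      RotatedPair v (Tile.move g '' P) :=
    ⟨_, mem_image_of_mem _ hS, g * f * g⁻¹, hv, S.move f, hS', by
      rw [Tile.move_move, Tile.move_move, inv_mul_cancel_right]⟩
  have hconj := conj_rotation_eq g.linearIsometryEquiv u
  rw [← hf] at hconj
  rcases hconj with h | h
  · exact conj_pair (h.trans hf)
  -- Conjugation by a reflection inverts the rotation, so the pair is used in the opposite order.
  · exact inv_inv u ▸ (conj_pair h).inv

end RotatedPair

namespace IsPinwheelLike

variable {𝒯 : Set (Tile ι)} {k : ℤ}

theorem infinite_image_direction_zpow (h : IsPinwheelLike 𝒯) (hk : k ≠ 0) :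
    ((fun T : Tile ι => T.direction ^ k) '' 𝒯).Infinite := by
  have hdir : (Tile.direction '' 𝒯).Infinite :=
    Infinite.of_image (fun z : ℂ => toIcoMod Real.two_pi_pos 0 (Complex.arg z)) <| by
      rw [image_image]
      exact h
  intro hfin
  refine hdir (Finite.of_finite_fibers (f := fun z : ℂ => z ^ k) ?_ fun w _ => ?_)
  · rwa [image_image]
  · exact (finite_setOf_zpow_eq hk w).subset inter_subset_right

theorem exists_rotatedPair [Finite ι] (h : IsPinwheelLike 𝒯) (hk : k ≠ 0) :
    ∃ u : Circle, u ^ k ≠ 1 ∧ RotatedPair u 𝒯 := by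
  obtain ⟨S, hS, T, hT, hST, hdir⟩ := exists_ne_of_infinite_image
    (h.infinite_image_direction_zpow hk)
    fun T : Tile ι => (T.kind, T.pos.linearIsometryEquiv ∈ rotation.range)
  obtain ⟨hkind, hrot⟩ := Prod.ext_iff.1 hST
  obtain ⟨u, hu⟩ : (T.pos * S.pos⁻¹).linearIsometryEquiv ∈ rotation.range := by
    rw [Motion.linear_mul, Motion.linear_inv,
      Subgroup.mul_mem_iff_of_index_two index_range_rotation, inv_mem_iff]
    exact hrot.symm.to_iff
  have hmove : S.move (T.pos * S.pos⁻¹) = T := Tile.move_pos_mul_inv_pos hkind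
  refine ⟨u, fun huk => hdir ?_, S, hS, _, hu.symm, hmove.symm ▸ hT⟩
  have hd := Tile.direction_move hu.symm S
  rw [hmove] at hd
  rw [hd, mul_zpow, ← Circle.coe_zpow, huk, Circle.coe_one, one_mul]

end IsPinwheelLike

/-! ### Cancellation in exponential sums over supertiles -/

theorem norm_one_add_lt_two {w : Circle} (hw : w ≠ 1) : ‖1 + (w : ℂ)‖ < 2 := by
  have hray : ¬ SameRay ℝ (1 : ℂ) w := fun h =>
    hw (Circle.ext ((sameRay_iff_of_norm_eq (by rw [norm_one, Circle.norm_coe])).1 h).symm)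
  refine (norm_add_lt_of_not_sameRay hray).trans_eq ?_
  rw [norm_one, Circle.norm_coe, one_add_one_eq_two]

theorem norm_sum_le_sum_sub_of_pair {α E : Type*} [SeminormedAddCommGroup E] {s : Finset α}
    {f : α → E} {w : α → ℝ} (hf : ∀ a ∈ s, ‖f a‖ ≤ w a) {a b : α} (ha : a ∈ s) (hb : b ∈ s)
    (hab : a ≠ b) {e : ℝ} (he : ‖f a + f b‖ ≤ w a + w b - e) :
    ‖∑ c ∈ s, f c‖ ≤ ∑ c ∈ s, w c - e := by
  classical
  have hsub : {a, b} ⊆ s := by simp [Finset.insert_subset_iff, ha, hb]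
  rw [← Finset.sum_sdiff hsub, ← Finset.sum_sdiff hsub, Finset.sum_pair hab, Finset.sum_pair hab,
    add_sub_assoc]
  exact (norm_add_le _ _).trans <| add_le_add
    (norm_sum_le_of_le _ fun c hc => hf c (Finset.sdiff_subset hc)) he

namespace Substitution

section Primitivity

variable (σ : Substitution ι)

theorem exists_mem_iterate_subst_of_pow_ne_zero [Fintype ι] [DecidableEq ι] {n : ℕ} {i j : ι}
    (h : (σ.matrix ^ n) i j ≠ 0) : ∃ S ∈ σ.subst^[n] {protoTile i}, S.kind = j := by
  induction n generalizing j with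
  | zero =>
    refine ⟨protoTile i, rfl, ?_⟩
    by_contra hne
    exact h (by rw [pow_zero]; exact Matrix.one_apply_ne hne)
  | succ n ih =>
    rw [pow_succ, Matrix.mul_apply] at h
    obtain ⟨l, -, hl⟩ := Finset.exists_ne_zero_of_sum_ne_zero h
    obtain ⟨S, hS, rfl⟩ := ih (left_ne_zero_of_mul hl)
    have hcard : (σ.maps S.kind j).card ≠ 0 := by
      simpa [matrix] using right_ne_zero_of_mul hl
    obtain ⟨φ, hφ⟩ := Finset.card_ne_zero.1 hcard
    refine ⟨⟨j, Motion.inflate σ.factor S.pos * φ⟩, ?_, rfl⟩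
    rw [Function.iterate_succ_apply']
    exact mem_biUnion hS ⟨φ, hφ, rfl⟩

/-- Every supertile of level `p` contains tiles of all kinds; for some `p` this is what primitivity
means geometrically. -/
def HasAllKinds [Finite ι] (p : ℕ) : Prop :=
  ∀ (T : Tile ι) (j : ι), ∃ S ∈ σ.supertileOf p T, S.kind = j

theorem exists_hasAllKinds [Fintype ι] [DecidableEq ι] (hprim : σ.matrix.IsPrimitive) :
    ∃ p > 0, σ.HasAllKinds p := by
  classical
  obtain ⟨p, hp, hpos⟩ := hprim.exists_pos_pow
  refine ⟨p, hp, fun T j => ?_⟩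
  obtain ⟨S, hS, hj⟩ := σ.exists_mem_iterate_subst_of_pow_ne_zero (hpos T.kind j).ne'
  rw [← T.move_pos_protoTile, supertileOf_move]
  exact ⟨_, Finset.mem_image_of_mem _ (σ.mem_supertileOf.2 hS), hj⟩

end Primitivity

variable [Finite ι] {σ : Substitution ι}

theorem rotatedPair_supertileOf_of_kind_eq {u : Circle} {n : ℕ} {S T : Tile ι}
    (hST : S.kind = T.kind) (h : RotatedPair u (σ.supertileOf n S : Set (Tile ι))) :
    RotatedPair u (σ.supertileOf n T : Set (Tile ι)) := by
  classical
  rw [← Tile.move_pos_mul_inv_pos hST, supertileOf_move, Finset.coe_image]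
  exact h.move _

theorem HasAllKinds.exists_rotatedPair_supertileOf {p : ℕ} (hp : σ.HasAllKinds p)
    {𝒯 : Set (Tile ι)} (h𝒯 : 𝒯 ∈ σ.tilingSpace) {u : Circle} (hu : RotatedPair u 𝒯) :
    ∃ n, ∀ T, RotatedPair u (σ.supertileOf n T : Set (Tile ι)) := by
  classical
  obtain ⟨S, hS, h, hh, hS'⟩ := hu
  obtain ⟨n, i, g, hsub⟩ := h𝒯.2 {S, S.move h} (pair_subset hS hS') (toFinite _)
  have hpair : RotatedPair u {S, S.move h} := ⟨S, by simp, h, hh, by simp⟩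
  have hproto : RotatedPair u (σ.supertileOf n (protoTile i) : Set (Tile ι)) := by
    rw [coe_supertileOf]
    exact (hpair.move g).mono hsub
  refine ⟨n + p, fun T => ?_⟩
  obtain ⟨A, hA, hAi⟩ := hp T i
  refine (rotatedPair_supertileOf_of_kind_eq (T := A) hAi.symm hproto).mono ?_
  rw [supertileOf_add]
  exact Finset.coe_subset.2 (Finset.subset_biUnion_of_mem (σ.supertileOf n) hA)

variable (σ) in
/-- The exponential sum `∑ exp (i k α(S))` over the tiles `S` of the supertile `σ^n(T)`. -/
def directionSum (k : ℤ) (n : ℕ) (T : Tile ι) : ℂ := ∑ S ∈ σ.supertileOf n T, S.direction ^ k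

theorem directionSum_move {g : Motion} {u : Circle} (hg : g.linearIsometryEquiv = rotation u)
    (k : ℤ) (n : ℕ) (T : Tile ι) :
    σ.directionSum k n (T.move g) = (u ^ k : Circle) * σ.directionSum k n T := by
  rw [directionSum, sum_supertileOf_move, directionSum, Finset.mul_sum]
  refine Finset.sum_congr rfl fun S _ => ?_
  rw [Tile.direction_move (u := u) (by rw [Motion.linear_inflate, hg]), mul_zpow, Circle.coe_zpow]

variable (σ) in
/-- On all supertiles of a suitable level, the mean of `f` has norm at most a prescribed
`ε > 0`. -/
def HasSmallSupertileMeans {E : Type*} [SeminormedAddCommGroup E] (f : Tile ι → E) : Prop :=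
  ∀ ε > 0, ∃ n, ∀ T, ‖∑ S ∈ σ.supertileOf n T, f S‖ ≤ ε * (σ.supertileOf n T).card

namespace IsSelfSimilar

variable (hσ : σ.IsSelfSimilar)

include hσ

theorem exists_card_supertileOf_add_le {p : ℕ} (hp : σ.HasAllKinds p) (n : ℕ) :
    ∃ C > 0, ∀ m S T, (σ.supertileOf (m + n) T).card ≤ C * (σ.supertileOf m S).card := by
  obtain ⟨C, hC⟩ := σ.exists_card_supertileOf_le n
  obtain ⟨D, hD⟩ := σ.exists_card_supertileOf_le p
  refine ⟨(C + 1) * (D + 1), by positivity, fun m S T => ?_⟩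
  have card_le (A : Tile ι) : (σ.supertileOf m A).card ≤ (D + 1) * (σ.supertileOf m S).card := by
    obtain ⟨B, hB, hBA⟩ := hp S A.kind
    calc (σ.supertileOf m A).card = (σ.supertileOf m B).card := by
          rw [σ.card_supertileOf m A, σ.card_supertileOf m B, hBA]
      _ ≤ (σ.supertileOf (m + p) S).card := by
          rw [hσ.card_supertileOf_add]
          exact Finset.single_le_sum (f := fun A => (σ.supertileOf m A).card) (by simp) hB
      _ = ∑ A ∈ σ.supertileOf m S, (σ.supertileOf p A).card := by
          rw [add_comm, hσ.card_supertileOf_add]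
      _ ≤ (D + 1) * (σ.supertileOf m S).card := by
          rw [mul_comm]
          exact Finset.sum_le_card_nsmul _ _ _ fun A _ => (hD p le_rfl A).trans D.le_succ
  calc (σ.supertileOf (m + n) T).card
      = ∑ A ∈ σ.supertileOf n T, (σ.supertileOf m A).card := hσ.card_supertileOf_add m n T
    _ ≤ (σ.supertileOf n T).card * ((D + 1) * (σ.supertileOf m S).card) :=
        Finset.sum_le_card_nsmul _ _ _ fun A _ => card_le A
    _ ≤ (C + 1) * (D + 1) * (σ.supertileOf m S).card := by
        rw [mul_assoc]
        exact Nat.mul_le_mul_right _ ((hC n le_rfl T).trans C.le_succ)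

theorem directionSum_add (k : ℤ) (m n : ℕ) (T : Tile ι) :
    σ.directionSum k (m + n) T = ∑ A ∈ σ.supertileOf n T, σ.directionSum k m A :=
  hσ.sum_supertileOf_add m n T _

theorem norm_directionSum_add_le {u : Circle} {k : ℤ} (hu : u ^ k ≠ 1) {m n : ℕ} {T : Tile ι}
    (hpair : RotatedPair u (σ.supertileOf n T : Set (Tile ι))) {C : ℕ} (hC : 0 < C)
    (hcard : ∀ S, (σ.supertileOf (m + n) T).card ≤ C * (σ.supertileOf m S).card) {q : ℝ}
    (hq : 0 ≤ q) (hsum : ∀ S, ‖σ.directionSum k m S‖ ≤ q * (σ.supertileOf m S).card) :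
    ‖σ.directionSum k (m + n) T‖ ≤
      (1 - (2 - ‖1 + ((u ^ k : Circle) : ℂ)‖) / C) * q * (σ.supertileOf (m + n) T).card := by
  obtain ⟨S, hS, h, hh, hS'⟩ := hpair
  set η := 2 - ‖1 + ((u ^ k : Circle) : ℂ)‖ with hη
  have hη0 : 0 ≤ η := (sub_pos.2 (norm_one_add_lt_two hu)).le
  have hcardS : (σ.supertileOf m (S.move h)).card = (σ.supertileOf m S).card := by
    rw [card_supertileOf, Tile.kind_move, ← card_supertileOf]
  have hne : S.move h ≠ S := Tile.move_ne_self hh (fun h1 => hu (by rw [h1, one_zpow])) S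
  have hcancel : ‖σ.directionSum k m S + σ.directionSum k m (S.move h)‖ ≤
      q * (σ.supertileOf m S).card + q * (σ.supertileOf m (S.move h)).card
        - η * (q * (σ.supertileOf m S).card) := by
    rw [directionSum_move hh, ← one_add_mul, norm_mul, hcardS, ← two_mul, ← sub_mul, hη,
      sub_sub_cancel]
    gcongr
    exact hsum S
  have hcardS' : ((σ.supertileOf (m + n) T).card : ℝ) / C ≤ (σ.supertileOf m S).card := by
    rw [div_le_iff₀' (by positivity)]
    exact_mod_cast hcard S
  calc ‖σ.directionSum k (m + n) T‖
      ≤ ∑ A ∈ σ.supertileOf n T, q * (σ.supertileOf m A).card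
          - η * (q * (σ.supertileOf m S).card) := by
        rw [hσ.directionSum_add]
        exact norm_sum_le_sum_sub_of_pair (fun A _ => hsum A) hS hS' hne.symm hcancel
    _ = q * (σ.supertileOf (m + n) T).card - η * q * (σ.supertileOf m S).card := by
        rw [← Finset.mul_sum, hσ.card_supertileOf_add, Nat.cast_sum, mul_assoc η]
    _ ≤ q * (σ.supertileOf (m + n) T).card
          - η * q * ((σ.supertileOf (m + n) T).card / C) := by gcongr
    _ = _ := by ring

theorem exists_norm_directionSum_le_pow_mul_card {p : ℕ} (hp : σ.HasAllKinds p) {u : Circle}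
    {k : ℤ} (hu : u ^ k ≠ 1) {n : ℕ}
    (hpair : ∀ T, RotatedPair u (σ.supertileOf n T : Set (Tile ι))) :
    ∃ δ < (1 : ℝ), ∀ l T,
      ‖σ.directionSum k (l * n) T‖ ≤ δ ^ l * (σ.supertileOf (l * n) T).card := by
  obtain ⟨C, hC, hcard⟩ := hσ.exists_card_supertileOf_add_le hp n
  have hη : 0 < 2 - ‖1 + ((u ^ k : Circle) : ℂ)‖ := sub_pos.2 (norm_one_add_lt_two hu)
  set δ := 1 - (2 - ‖1 + ((u ^ k : Circle) : ℂ)‖) / C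
  refine ⟨max 0 δ, max_lt one_pos (sub_lt_self _ (by positivity)), fun l => ?_⟩
  induction l with
  | zero => simp [directionSum, supertileOf_zero]
  | succ l ih =>
    intro T
    rw [Nat.succ_mul, pow_succ']
    refine (hσ.norm_directionSum_add_le hu (hpair T) hC (fun S => hcard _ S T) (by positivity)
      ih).trans ?_
    gcongr
    exact le_max_right _ _

theorem hasSmallSupertileMeans_direction_zpow {p : ℕ} (hp : σ.HasAllKinds p) {𝒯 : Set (Tile ι)}
    (h𝒯 : 𝒯 ∈ σ.tilingSpace) (hpin : IsPinwheelLike 𝒯) {k : ℤ} (hk : k ≠ 0) :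
    σ.HasSmallSupertileMeans fun T => T.direction ^ k := by
  intro ε hε
  obtain ⟨u, hu, hpair⟩ := hpin.exists_rotatedPair hk
  obtain ⟨n, hn⟩ := hp.exists_rotatedPair_supertileOf h𝒯 hpair
  obtain ⟨δ, hδ1, hδ⟩ := hσ.exists_norm_directionSum_le_pow_mul_card hp hu hn
  obtain ⟨l, hl⟩ := exists_pow_lt_of_lt_one hε hδ1
  exact ⟨l * n, fun T => (hδ l T).trans (by gcongr)⟩

end IsSelfSimilar

end Substitution

/-! ### Means along enumerations of the tiles -/

theorem volume_real_closedBall_diff_ball_le {r R : ℝ} (hR : 0 ≤ R) (hrR : r ≤ R) :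
    volume.real (Metric.closedBall (0 : ℂ) R \ Metric.ball 0 r) ≤
      2 * Real.pi * R * (R - r) := by
  have hπ := Real.pi_pos
  rw [measureReal_sdiff (Metric.ball_subset_closedBall.trans (Metric.closedBall_subset_closedBall
    hrR)) measurableSet_ball measure_closedBall_lt_top.ne]
  simp only [measureReal_def, Complex.volume_closedBall, Complex.volume_ball, ENNReal.toReal_mul,
    ENNReal.toReal_pow, ENNReal.coe_toReal, NNReal.coe_real_pi, ENNReal.toReal_ofReal hR,
    ENNReal.toReal_ofReal']
  rcases le_total r 0 with hr | hr
  · rw [max_eq_right hr]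
    nlinarith [mul_nonneg hπ.le hR, mul_nonneg (mul_nonneg hπ.le hR) (neg_nonneg.2 hr)]
  · rw [max_eq_left hr]
    nlinarith [mul_nonneg hπ.le (sq_nonneg (R - r))]

theorem eventually_mul_add_one_le_of_sq_le {a C ε : ℝ} (ha : 0 < a) (hε : 0 < ε) :
    ∀ᶠ n : ℕ in atTop, ∀ R : ℝ, R ^ 2 ≤ a * n → C * (R + 1) ≤ ε * n := by
  filter_upwards [tendsto_natCast_atTop_atTop.eventually_ge_atTop
    ((C + a * C ^ 2 / (2 * ε)) / (ε / 2))] with n hn R hR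
  rw [div_le_iff₀ (by positivity)] at hn
  have hR' : ε / (2 * a) * R ^ 2 ≤ ε / 2 * n := by
    calc ε / (2 * a) * R ^ 2 ≤ ε / (2 * a) * (a * n) := by gcongr
      _ = ε / 2 * n := by field_simp
  have amgm : C * R ≤ ε / (2 * a) * R ^ 2 + a * C ^ 2 / (2 * ε) := by
    have hsq : ε / (2 * a) * R ^ 2 + a * C ^ 2 / (2 * ε) - C * R =
        ε / (2 * a) * (R - a * C / ε) ^ 2 := by
      field_simp
      ring
    have : 0 ≤ ε / (2 * a) * (R - a * C / ε) ^ 2 := by positivity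
    linarith
  linarith

namespace Substitution

variable {σ : Substitution ι}

theorem IsPacking.sum_volume_interior_le {P : Finset (Tile ι)} (hP : σ.IsPacking P) {U : Set ℂ}
    (hU : volume U ≠ ⊤) (hPU : ∀ T ∈ P, interior (σ.support T) ⊆ U) :
    ∑ T ∈ P, volume.real (interior (σ.support T)) ≤ volume.real U := by
  rw [← measureReal_biUnion_finset hP (fun T _ => isOpen_interior.measurableSet)
    (fun T _ => σ.volume_interior_support_ne_top T)]
  exact measureReal_mono (iUnion₂_subset hPU) hU

theorem IsPacking.mem_of_interior_subset {Q : Set (Tile ι)} (hQ : σ.IsPacking Q)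
    {P : Finset (Tile ι)} (hP : (P : Set (Tile ι)) ⊆ Q) {S : Tile ι} (hS : S ∈ Q)
    (hcov : interior (σ.support S) ⊆ ⋃ T ∈ P, σ.support T) : S ∈ P := by
  by_contra hSP
  -- Baire: the complement of the interior of `S` and the tiles of `P` are closed and cover `ℂ`.
  let f : Option P → Set ℂ := fun o => o.elim (interior (σ.support S))ᶜ fun T => σ.support T
  have hclosed : ∀ o, IsClosed (f o) := by
    rintro (_ | T)
    · exact isOpen_interior.isClosed_compl
    · exact (σ.isCompact_support T).isClosed
  have hunion : ⋃ o, f o = univ := by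
    refine eq_univ_of_forall fun z => mem_iUnion.2 ?_
    by_cases hz : z ∈ interior (σ.support S)
    · obtain ⟨T, hT, hzT⟩ := mem_iUnion₂.1 (hcov hz)
      exact ⟨some ⟨T, hT⟩, hzT⟩
    · exact ⟨none, hz⟩
  obtain ⟨z, hz, hz'⟩ := (dense_iUnion_interior_of_closed hclosed hunion).inter_open_nonempty _
    isOpen_interior (σ.nonempty_interior_support S)
  obtain ⟨_ | T, ho⟩ := mem_iUnion.1 hz'
  · exact interior_subset ho hz
  · exact disjoint_left.1 (hQ hS (hP T.2) fun h => hSP (h ▸ T.2)) hz ho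

variable (σ) in
/-- The patch of a tiling formed by the tiles at distance less than `R` from the origin, together
with some of the tiles at distance exactly `R`. -/
structure IsDiscPatch (R : ℝ) (P : Finset (Tile ι)) : Prop where
  ball_subset : Metric.ball 0 R ⊆ ⋃ T ∈ P, σ.support T
  infDist_le : ∀ T ∈ P, Metric.infDist 0 (σ.support T) ≤ R

theorem IsOrderedByDistance.isDiscPatch [DecidableEq (Tile ι)] {𝒯 : Set (Tile ι)}
    (h𝒯 : σ.IsTiling 𝒯) {s : ℕ → Tile ι} (hs : σ.IsOrderedByDistance 𝒯 s) (n : ℕ) :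
    σ.IsDiscPatch (Metric.infDist 0 (σ.support (s n))) ((Finset.range n).image s) where
  ball_subset z hz := by
    obtain ⟨T, hT, hzT⟩ := mem_iUnion₂.1 (h𝒯.covers.symm.subset (mem_univ z))
    obtain ⟨j, -, rfl⟩ := hs.1.surjOn hT
    refine mem_biUnion (Finset.mem_coe.2 (Finset.mem_image_of_mem s (Finset.mem_range.2 ?_))) hzT
    by_contra! hle
    have hj := (hs.2 hle).trans (Metric.infDist_le_dist_of_mem (x := (0 : ℂ)) hzT)
    exact hj.not_gt (Metric.mem_ball'.1 hz)
  infDist_le := by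
    simp only [Finset.forall_mem_image, Finset.mem_range]
    exact fun j hj => hs.2 hj.le

variable [Finite ι]

variable (σ) in
theorem exists_sq_le_mul_card : ∃ a > 0, ∀ ⦃R : ℝ⦄, 0 ≤ R → ∀ P, σ.IsDiscPatch R P →
    R ^ 2 ≤ a * P.card := by
  obtain ⟨a, ha, haσ⟩ := σ.exists_volume_support_le
  refine ⟨a, ha, fun R hR P hP => ?_⟩
  calc R ^ 2 ≤ R ^ 2 * Real.pi :=
        le_mul_of_one_le_right (sq_nonneg R) (one_le_two.trans Real.two_le_pi)
    _ = volume.real (Metric.ball (0 : ℂ) R) := by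
        simp [measureReal_def, Complex.volume_ball, ENNReal.toReal_ofReal hR]
    _ ≤ volume.real (⋃ T ∈ P, σ.support T) :=
        measureReal_mono hP.ball_subset
          (P.isCompact_biUnion fun T _ => σ.isCompact_support T).measure_ne_top
    _ ≤ ∑ T ∈ P, volume.real (σ.support T) := measureReal_biUnion_finset_le _ _
    _ ≤ a * P.card := by
        rw [mul_comm, ← nsmul_eq_mul]
        exact Finset.sum_le_card_nsmul _ _ _ fun T _ => haσ T

variable (σ) in
theorem exists_card_le_of_infDist_mem_Icc {D : ℝ} (hD : 0 ≤ D) :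
    ∃ C, ∀ ⦃P : Finset (Tile ι)⦄, σ.IsPacking P → ∀ ⦃R : ℝ⦄, 0 ≤ R →
      (∀ T ∈ P, Metric.infDist 0 (σ.support T) ∈ Icc (R - D) R) → P.card ≤ C * (R + 1) := by
  obtain ⟨d, hd, hdσ⟩ := σ.exists_diam_support_le
  obtain ⟨b, hb, hbσ⟩ := σ.exists_le_volume_interior_support
  refine ⟨2 * Real.pi * (D + d) * (d + 1) / b, fun P hP R hR hPR => ?_⟩
  have hsub : ∀ T ∈ P, interior (σ.support T) ⊆
      Metric.closedBall 0 (R + d) \ Metric.ball 0 (R - D) := by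
    refine fun T hT z hz => ⟨Metric.mem_closedBall'.2 ?_, fun hz' => ?_⟩
    · exact (Metric.dist_le_infDist_add_diam (σ.isCompact_support T).isBounded
        (interior_subset hz)).trans (add_le_add (hPR T hT).2 (hdσ T))
    · exact ((hPR T hT).1.trans (Metric.infDist_le_dist_of_mem (interior_subset hz))).not_gt
        (Metric.mem_ball'.1 hz')
  rw [div_mul_eq_mul_div, le_div_iff₀ hb]
  calc (P.card : ℝ) * b ≤ ∑ T ∈ P, volume.real (interior (σ.support T)) := by
        rw [← nsmul_eq_mul]
        exact Finset.card_nsmul_le_sum _ _ _ fun T _ => hbσ T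
    _ ≤ volume.real (Metric.closedBall (0 : ℂ) (R + d) \ Metric.ball 0 (R - D)) :=
        hP.sum_volume_interior_le
          (measure_ne_top_of_subset sdiff_subset measure_closedBall_lt_top.ne) hsub
    _ ≤ 2 * Real.pi * (R + d) * (R + d - (R - D)) :=
        volume_real_closedBall_diff_ball_le (by positivity) (by linarith)
    _ = 2 * Real.pi * (D + d) * (R + d) := by ring
    _ ≤ 2 * Real.pi * (D + d) * ((d + 1) * (R + 1)) := by
        gcongr
        nlinarith
    _ = _ := by ring

theorem HasAllKinds.exists_mem_supertileOf {p : ℕ} (hp : σ.HasAllKinds p) (h0 : σ.factor ≠ 0)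
    (T : Tile ι) : ∃ A, T ∈ σ.supertileOf p A := by
  classical
  obtain ⟨S, hS, hST⟩ := hp T T.kind
  obtain ⟨h, hh⟩ := Motion.inflate_surjective (pow_ne_zero p h0) (T.pos * S.pos⁻¹)
  refine ⟨T.move h, ?_⟩
  rw [supertileOf_move, hh]
  exact Finset.mem_image.2 ⟨S, hS, Tile.move_pos_mul_inv_pos hST⟩

theorem supertileOf_subset_supertileOf_add {n : ℕ} {S T : Tile ι} (h : S ∈ σ.supertileOf n T)
    (m : ℕ) : σ.supertileOf m S ⊆ σ.supertileOf (m + n) T := by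
  classical
  rw [supertileOf_add]
  exact Finset.subset_biUnion_of_mem (σ.supertileOf m) h

theorem HasAllKinds.exists_subset_supertileOf {p : ℕ} (hp : σ.HasAllKinds p) (hp0 : 0 < p)
    (h0 : σ.factor ≠ 0) {𝒯 : Set (Tile ι)} (h𝒯 : 𝒯 ∈ σ.tilingSpace) {P : Finset (Tile ι)}
    (hP : (P : Set (Tile ι)) ⊆ 𝒯) (K : ℕ) : ∃ m T, P ⊆ σ.supertileOf (K + m) T := by
  induction K with
  | zero =>
    obtain ⟨n, i, g, hsub⟩ := h𝒯.2 P hP P.finite_toSet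
    obtain ⟨m, T, hT⟩ := IsSupertile.exists_eq_supertileOf h0 ⟨n, i, g⁻¹, rfl⟩
    refine ⟨m, T, fun S hS => ?_⟩
    rw [zero_add, ← Finset.mem_coe, ← hT]
    exact ⟨S.move g, hsub (mem_image_of_mem _ hS), by simp [Tile.move_move]⟩
  | succ K ih =>
    obtain ⟨m, T, hT⟩ := ih
    obtain ⟨A, hA⟩ := hp.exists_mem_supertileOf h0 T
    refine ⟨m + (p - 1), A, ?_⟩
    rw [show K + 1 + (m + (p - 1)) = K + m + p by lia]
    exact hT.trans (supertileOf_subset_supertileOf_add hA _)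

namespace IsSelfSimilar

variable (hσ : σ.IsSelfSimilar)

include hσ

section Sums

variable {E : Type*} [SeminormedAddCommGroup E] {f : Tile ι → E} {ε : ℝ} {K m n : ℕ} {T : Tile ι}
  {P : Finset (Tile ι)}

theorem norm_sum_biUnion_supertileOf_le [DecidableEq (Tile ι)]
    (hK : ∀ T, ‖∑ S ∈ σ.supertileOf K T, f S‖ ≤ ε * (σ.supertileOf K T).card)
    (hP : σ.IsPacking P) :
    ‖∑ S ∈ P.biUnion (σ.supertileOf K), f S‖ ≤ ε * (P.biUnion (σ.supertileOf K)).card := by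
  have hdisj : (P : Set (Tile ι)).PairwiseDisjoint (σ.supertileOf K) :=
    fun A hA B hB hne => hσ.disjoint_supertileOf K (hP hA hB hne)
  rw [Finset.sum_biUnion hdisj, Finset.card_biUnion hdisj, Nat.cast_sum, Finset.mul_sum]
  exact norm_sum_le_of_le _ fun A _ => hK A

theorem norm_sum_supertileOf_le_of_le
    (hK : ∀ T, ‖∑ S ∈ σ.supertileOf K T, f S‖ ≤ ε * (σ.supertileOf K T).card) (hn : K ≤ n)
    (T : Tile ι) : ‖∑ S ∈ σ.supertileOf n T, f S‖ ≤ ε * (σ.supertileOf n T).card := by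
  classical
  obtain ⟨m, rfl⟩ := Nat.exists_eq_add_of_le hn
  rw [supertileOf_add]
  exact hσ.norm_sum_biUnion_supertileOf_le hK (hσ.isPacking_supertileOf m T)

open Classical in
theorem norm_sum_le_add_card_boundary (hε : 0 ≤ ε)
    (hK : ∀ T, ‖∑ S ∈ σ.supertileOf K T, f S‖ ≤ ε * (σ.supertileOf K T).card)
    (hf : ∀ T, ‖f T‖ ≤ 1) (hP : P ⊆ σ.supertileOf (K + m) T) :
    ‖∑ S ∈ P, f S‖ ≤ ε * P.card + (P.filter fun S => ∃ A, S ∈ σ.supertileOf K A ∧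
      σ.supertileOf K A ⊆ σ.supertileOf (K + m) T ∧ ¬ σ.supertileOf K A ⊆ P).card := by
  set ℬ := (σ.supertileOf m T).filter fun A => σ.supertileOf K A ⊆ P
  set G := ℬ.biUnion (σ.supertileOf K)
  have hGP : G ⊆ P := Finset.biUnion_subset.2 fun A hA => (Finset.mem_filter.1 hA).2
  have hG : ‖∑ S ∈ G, f S‖ ≤ ε * P.card :=
    (hσ.norm_sum_biUnion_supertileOf_le hK ((hσ.isPacking_supertileOf m T).mono
      (Finset.coe_subset.2 (Finset.filter_subset _ _)))).trans (by gcongr)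
  rw [← Finset.sum_sdiff hGP, add_comm]
  refine (norm_add_le _ _).trans (add_le_add hG ?_)
  calc ‖∑ S ∈ P \ G, f S‖ ≤ (P \ G).card := by
        simpa using norm_sum_le_of_le (P \ G) fun S _ => hf S
    _ ≤ _ := by
        refine Nat.cast_le.2 (Finset.card_le_card fun S hS => ?_)
        obtain ⟨hSP, hSG⟩ := Finset.mem_sdiff.1 hS
        have hST := hP hSP
        rw [supertileOf_add, Finset.mem_biUnion] at hST
        obtain ⟨A, hA, hSA⟩ := hST
        refine Finset.mem_filter.2 ⟨hSP, A, hSA, supertileOf_subset_supertileOf_add hA K, fun hAP =>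
          hSG (Finset.mem_biUnion.2 ⟨A, Finset.mem_filter.2 ⟨hA, hAP⟩, hSA⟩)⟩

theorem isLittleO_sum_range_along_supertiles (hf : σ.HasSmallSupertileMeans f) {s : ℕ → Tile ι}
    (hs : Function.Injective s) :
    (fun n => ∑ j ∈ Finset.range n, f (s j))
      =o[atTop ⊓ 𝓟 {n | σ.IsSupertile (s '' Iio n)}] fun n => (n : ℝ) := by
  classical
  refine Asymptotics.isLittleO_iff.2 fun ε hε => ?_
  obtain ⟨K, hK⟩ := hf ε hε
  obtain ⟨C, hC⟩ := σ.exists_card_supertileOf_le K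
  rw [eventually_inf_principal]
  filter_upwards [eventually_gt_atTop C] with n hn hsup
  obtain ⟨k, T, hT⟩ := hsup.exists_eq_supertileOf hσ.factor_ne_zero
  have himage : (Finset.range n).image s = σ.supertileOf k T := by
    rw [← Finset.coe_inj, Finset.coe_image, Finset.coe_range, hT]
  have hcard : (σ.supertileOf k T).card = n := by
    rw [← himage, Finset.card_image_of_injective _ hs, Finset.card_range]
  have hKk : K ≤ k := by
    by_contra! hlt
    exact (hcard.symm.trans_le (hC k hlt.le T)).not_gt hn
  have hsum := hσ.norm_sum_supertileOf_le_of_le hK hKk T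
  rwa [hcard, ← himage, Finset.sum_image hs.injOn, ← Real.norm_natCast] at hsum

end Sums

theorem sub_le_infDist_of_not_supertileOf_subset {d : ℝ}
    (hd : ∀ T, Metric.diam (σ.support T) ≤ d) {R : ℝ} {P : Finset (Tile ι)}
    (hP : σ.IsDiscPatch R P) {Q : Set (Tile ι)} (hQ : σ.IsPacking Q) (hPQ : ↑P ⊆ Q) {K : ℕ}
    {A S : Tile ι} (hAQ : ↑(σ.supertileOf K A) ⊆ Q) (hAP : ¬ σ.supertileOf K A ⊆ P)
    (hS : S ∈ σ.supertileOf K A) :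
    R - σ.factor ^ K * d ≤ Metric.infDist 0 (σ.support S) := by
  obtain ⟨B, hBA, hBP⟩ := Finset.not_subset.1 hAP
  obtain ⟨z, hz, hzR⟩ : ∃ z ∈ interior (σ.support B), z ∉ Metric.ball 0 R := by
    refine not_subset.1 fun hsub => hBP ?_
    exact hQ.mem_of_interior_subset hPQ (hAQ hBA) (hsub.trans hP.ball_subset)
  have hzA : z ∈ σ.factor ^ K • σ.support A :=
    hσ.support_subset_of_mem_iterate_subst (σ.mem_supertileOf.1 hBA) (interior_subset hz)
  have hSA : σ.support S ⊆ σ.factor ^ K • σ.support A :=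
    hσ.support_subset_of_mem_iterate_subst (σ.mem_supertileOf.1 hS)
  have hK : 0 ≤ σ.factor ^ K := pow_nonneg hσ.factor_pos.le K
  rw [sub_le_iff_le_add]
  calc R ≤ dist 0 z := not_lt.1 fun h => hzR (Metric.mem_ball'.2 h)
    _ ≤ Metric.infDist 0 (σ.factor ^ K • σ.support A) + Metric.diam (σ.factor ^ K • σ.support A) :=
        Metric.dist_le_infDist_add_diam ((σ.isCompact_support A).smul _).isBounded hzA
    _ ≤ Metric.infDist 0 (σ.support S) + σ.factor ^ K * d := by
        rw [diam_smul₀, Real.norm_of_nonneg hK]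
        gcongr
        · exact Metric.infDist_le_infDist_of_subset hSA (σ.nonempty_support S)
        · exact hd A

variable {p : ℕ} (hp : σ.HasAllKinds p) (hp0 : 0 < p) {𝒯 : Set (Tile ι)} (h𝒯 : 𝒯 ∈ σ.tilingSpace)
  {E : Type*} [SeminormedAddCommGroup E] {f : Tile ι → E} (hf1 : ∀ T, ‖f T‖ ≤ 1)

include hp hp0 h𝒯 hf1

theorem exists_norm_sum_discPatch_le {ε : ℝ} (hε : 0 ≤ ε) {K : ℕ}
    (hK : ∀ T, ‖∑ S ∈ σ.supertileOf K T, f S‖ ≤ ε * (σ.supertileOf K T).card) :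
    ∃ C, ∀ ⦃R : ℝ⦄, 0 ≤ R → ∀ P, σ.IsDiscPatch R P → ↑P ⊆ 𝒯 →
      ‖∑ S ∈ P, f S‖ ≤ ε * P.card + C * (R + 1) := by
  classical
  obtain ⟨d, hd, hdσ⟩ := σ.exists_diam_support_le
  obtain ⟨C, hCσ⟩ := σ.exists_card_le_of_infDist_mem_Icc (D := σ.factor ^ K * d)
    (mul_nonneg (pow_nonneg hσ.factor_pos.le K) hd.le)
  refine ⟨C, fun R hR P hP hP𝒯 => ?_⟩
  obtain ⟨m, T, hPT⟩ := hp.exists_subset_supertileOf hp0 hσ.factor_ne_zero h𝒯 hP𝒯 K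
  have hpack := hσ.isPacking_supertileOf (K + m) T
  have hPT' := Finset.coe_subset.2 hPT
  refine (hσ.norm_sum_le_add_card_boundary hε hK hf1 hPT).trans ?_
  gcongr
  refine hCσ (hpack.mono ((Finset.coe_subset.2 (Finset.filter_subset _ _)).trans hPT')) hR ?_
  intro S hS
  obtain ⟨hSP, A, hSA, hAT, hAP⟩ := Finset.mem_filter.1 hS
  exact ⟨hσ.sub_le_infDist_of_not_supertileOf_subset hdσ hP hpack hPT' (Finset.coe_subset.2 hAT)
    hAP hSA, hP.infDist_le S hSP⟩

theorem isLittleO_sum_range_by_distance (hf : σ.HasSmallSupertileMeans f) {s : ℕ → Tile ι}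
    (hs : σ.IsOrderedByDistance 𝒯 s) :
    (fun n => ∑ j ∈ Finset.range n, f (s j)) =o[atTop] fun n => (n : ℝ) := by
  classical
  have hinj : Function.Injective s := injOn_univ.1 hs.1.injOn
  refine Asymptotics.isLittleO_iff.2 fun ε hε => ?_
  obtain ⟨K, hK⟩ := hf (ε / 2) (half_pos hε)
  obtain ⟨C, hsum⟩ := hσ.exists_norm_sum_discPatch_le hp hp0 h𝒯 hf1 (half_pos hε).le hK
  obtain ⟨a, ha, hsq⟩ := σ.exists_sq_le_mul_card
  filter_upwards [eventually_mul_add_one_le_of_sq_le (C := C) ha (half_pos hε)] with n hn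
  have hpatch := hs.isDiscPatch h𝒯.1 n
  have hcard : ((Finset.range n).image s).card = n := by
    rw [Finset.card_image_of_injective _ hinj, Finset.card_range]
  have hsub : ↑((Finset.range n).image s) ⊆ 𝒯 := by
    rw [Finset.coe_image]
    exact (image_mono (subset_univ _)).trans hs.1.image_eq.subset
  have hR := hn _ (hcard ▸ hsq Metric.infDist_nonneg _ hpatch)
  have hP := hsum Metric.infDist_nonneg _ hpatch hsub
  rw [hcard, Finset.sum_image hinj.injOn] at hP
  rw [Real.norm_natCast]
  linarith

end IsSelfSimilar

end Substitution


/-! ### Weyl's criterion -/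

section Weyl

theorem tendsto_of_tendsto_integral_fourier {P : ℝ} [Fact (0 < P)] {κ : Type*} {l : Filter κ}
    {μ : κ → ProbabilityMeasure (AddCircle P)} {ν : ProbabilityMeasure (AddCircle P)}
    (h : ∀ k : ℤ, Tendsto (fun n => ∫ t, fourier k t ∂(μ n : Measure (AddCircle P))) l
      (𝓝 (∫ t, fourier k t ∂(ν : Measure (AddCircle P))))) :
    Tendsto μ l (𝓝 ν) := by
  have hint (ρ : ProbabilityMeasure (AddCircle P)) (g : C(AddCircle P, ℂ)) :
      Integrable g (ρ : Measure (AddCircle P)) :=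
    g.continuous.integrable_of_hasCompactSupport (HasCompactSupport.of_compactSpace _)
  have hspan : ∀ g ∈ Submodule.span ℂ (range (fourier : ℤ → C(AddCircle P, ℂ))),
      Tendsto (fun n => ∫ t, g t ∂(μ n)) l (𝓝 (∫ t, g t ∂ν)) := fun g hg => by
    induction hg using Submodule.span_induction with
    | mem g hg =>
      obtain ⟨k, rfl⟩ := hg
      exact h k
    | zero => simpa using tendsto_const_nhds
    | add g g' _ _ ih ih' =>
      simpa only [ContinuousMap.add_apply, integral_add (hint _ g) (hint _ g')] using ih.add ih'
    | smul c g _ ih =>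
      simpa only [ContinuousMap.smul_apply, integral_smul] using ih.const_smul c
  refine ProbabilityMeasure.tendsto_of_tight_of_separatesPoints ℂ
    (A := fourierSubalgebra.comap (BoundedContinuousFunction.toContinuousMapStarₐ ℂ))
    IsTightMeasureSet.of_compactSpace ?_ fun g hg => ?_
  · intro x y hxy
    obtain ⟨_, ⟨g, hg, rfl⟩, hne⟩ := fourierSubalgebra_separatesPoints hxy
    exact ⟨g, ⟨g, ⟨BoundedContinuousFunction.mkOfCompact g, hg, rfl⟩, rfl⟩, hne⟩
  · refine hspan g.toContinuousMap ?_
    rw [← fourierSubalgebra_coe]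
    exact hg

theorem integral_fourier_haarAddCircle {P : ℝ} [Fact (0 < P)] {k : ℤ} (hk : k ≠ 0) :
    ∫ t, fourier k t ∂(AddCircle.haarAddCircle : Measure (AddCircle P)) = 0 := by
  simpa [fourierCoeff, Pi.single_eq_of_ne hk.symm] using
    congrFun (fourierCoeff_fourier (T := P) k) 0

section EmpiricalMeasure

variable {α : Type*} [MeasurableSpace α] (x : ℕ → α)

/-- The uniform distribution on the first `n` terms of a sequence; for `n = 0`, the first term is
used, so that the measure is always a probability measure. -/
def empiricalMeasure (n : ℕ) : Measure α :=
  ((max n 1 : ℕ) : ENNReal)⁻¹ • ∑ j ∈ Finset.range (max n 1), Measure.dirac (x j)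

instance (n : ℕ) : IsProbabilityMeasure (empiricalMeasure x n) where
  measure_univ := by
    have h : ((max n 1 : ℕ) : ENNReal) ≠ 0 := Nat.cast_ne_zero.2 (by omega)
    simpa [empiricalMeasure] using ENNReal.inv_mul_cancel h (ENNReal.natCast_ne_top _)

theorem integral_empiricalMeasure {E : Type*} [NormedAddCommGroup E] [NormedSpace ℝ E]
    [CompleteSpace E] {n : ℕ} (hn : n ≠ 0) {f : α → E} (hf : StronglyMeasurable f) :
    ∫ t, f t ∂(empiricalMeasure x n) = (n : ℝ)⁻¹ • ∑ j ∈ Finset.range n, f (x j) := by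
  rw [empiricalMeasure, max_eq_left (Nat.one_le_iff_ne_zero.2 hn), integral_smul_measure,
    integral_finsetSum_measure fun j _ => integrable_dirac' hf (by finiteness)]
  simp only [integral_dirac' _ _ hf, ENNReal.toReal_inv, ENNReal.toReal_natCast]

open Classical in
theorem empiricalMeasure_real_apply {n : ℕ} (hn : n ≠ 0) {s : Set α} (hs : MeasurableSet s) :
    (empiricalMeasure x n).real s =
      (((Finset.range n).filter fun j => x j ∈ s).card : ℝ) / n := by
  rw [empiricalMeasure, max_eq_left (Nat.one_le_iff_ne_zero.2 hn)]
  simp [measureReal_def, Measure.dirac_apply' _ hs,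
    indicator_apply, div_eq_inv_mul]

end EmpiricalMeasure

variable {P : ℝ}

theorem tendsto_integral_fourier_empiricalMeasure [Fact (0 < P)] {l : Filter ℕ} (hl : l ≤ atTop)
    {x : ℕ → AddCircle P} (h : ∀ k : ℤ, k ≠ 0 →
      (fun n => ∑ j ∈ Finset.range n, fourier k (x j)) =o[l] fun n => (n : ℝ)) (k : ℤ) :
    Tendsto (fun n => ∫ t, fourier k t ∂(empiricalMeasure x n)) l
      (𝓝 (∫ t, fourier k t ∂(AddCircle.haarAddCircle : Measure (AddCircle P)))) := by
  rcases eq_or_ne k 0 with rfl | hk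
  · simpa using tendsto_const_nhds
  rw [integral_fourier_haarAddCircle hk]
  refine (h k hk).tendsto_inv_smul_nhds_zero.congr' ?_
  filter_upwards [hl (eventually_ne_atTop 0)] with n hn
  rw [integral_empiricalMeasure x hn (fourier k).continuous.stronglyMeasurable]

open Classical in
theorem tendsto_frequency_of_isLittleO_sum_fourier [Fact (0 < P)] {l : Filter ℕ} (hl : l ≤ atTop)
    {x : ℕ → AddCircle P} (h : ∀ k : ℤ, k ≠ 0 →
      (fun n => ∑ j ∈ Finset.range n, fourier k (x j)) =o[l] fun n => (n : ℝ))
    {s : Set (AddCircle P)} (hs : MeasurableSet s)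
    (hs0 : AddCircle.haarAddCircle (frontier s) = 0) :
    Tendsto (fun n : ℕ => (((Finset.range n).filter fun j => x j ∈ s).card : ℝ) / n) l
      (𝓝 (AddCircle.haarAddCircle.real s)) := by
  let μ (n : ℕ) : ProbabilityMeasure (AddCircle P) := ⟨empiricalMeasure x n, inferInstance⟩
  let ν : ProbabilityMeasure (AddCircle P) := ⟨AddCircle.haarAddCircle, inferInstance⟩
  have hlim : Tendsto μ l (𝓝 ν) :=
    tendsto_of_tendsto_integral_fourier (tendsto_integral_fourier_empiricalMeasure hl h)
  have hmeas : Tendsto (fun n => (empiricalMeasure x n).real s) l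
      (𝓝 (AddCircle.haarAddCircle.real s)) :=
    (ENNReal.tendsto_toReal (measure_ne_top _ s)).comp
      (ProbabilityMeasure.tendsto_measure_of_null_frontier_of_tendsto' hlim hs0)
  refine hmeas.congr' ?_
  filter_upwards [hl (eventually_ne_atTop 0)] with n hn
  rw [empiricalMeasure_real_apply x hn hs]

variable {x y : ℝ}

theorem isClosed_coe_image_Icc : IsClosed (((↑) : ℝ → AddCircle P) '' Icc x y) :=
  (isCompact_Icc.image (AddCircle.continuous_mk' P)).isClosed

theorem frontier_coe_image_Icc_subset :
    frontier (((↑) : ℝ → AddCircle P) '' Icc x y) ⊆ {(x : AddCircle P), (y : AddCircle P)} := by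
  have hopen : IsOpen (((↑) : ℝ → AddCircle P) '' Ioo x y) :=
    QuotientAddGroup.isOpenMap_coe _ isOpen_Ioo
  rw [isClosed_coe_image_Icc.frontier_eq]
  rintro _ ⟨⟨r, hr, rfl⟩, hnot⟩
  rcases hr.1.eq_or_lt with rfl | hxr
  · exact Or.inl rfl
  rcases hr.2.eq_or_lt with rfl | hry
  · exact Or.inr rfl
  exact absurd (interior_maximal (image_mono Ioo_subset_Icc_self) hopen
    (mem_image_of_mem _ ⟨hxr, hry⟩)) hnot

variable [hP : Fact (0 < P)]

theorem coe_mem_image_Icc_iff (hx : 0 ≤ x) (hy : y < P) {t : ℝ} (ht : t ∈ Ico 0 P) :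
    (t : AddCircle P) ∈ ((↑) : ℝ → AddCircle P) '' Icc x y ↔ t ∈ Icc x y := by
  refine ⟨?_, fun h => mem_image_of_mem _ h⟩
  rintro ⟨r, hr, hrt⟩
  have hr' : r ∈ Ico 0 P := ⟨hx.trans hr.1, hr.2.trans_lt hy⟩
  rwa [← (AddCircle.coe_eq_coe_iff_of_mem_Ico (a := 0) (by simpa using hr')
    (by simpa using ht)).1 hrt]

theorem haarAddCircle_real_coe_image_Icc (hx : 0 ≤ x) (hxy : x ≤ y) (hy : y < P) :
    AddCircle.haarAddCircle.real (((↑) : ℝ → AddCircle P) '' Icc x y) = (y - x) / P := by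
  have hinter : ((↑) : ℝ → AddCircle P) ⁻¹' (((↑) : ℝ → AddCircle P) '' Icc x y) ∩ Ico 0 P
      = Icc x y := by
    ext t
    refine ⟨fun ⟨h, ht⟩ => (coe_mem_image_Icc_iff hx hy ht).1 h, fun h => ?_⟩
    exact ⟨mem_image_of_mem _ h, hx.trans h.1, h.2.trans_lt hy⟩
  have hvol : volume (((↑) : ℝ → AddCircle P) '' Icc x y) = ENNReal.ofReal (y - x) := by
    rw [AddCircle.add_projection_respects_measure P 0 isClosed_coe_image_Icc.measurableSet,
      zero_add, measure_congr ((ae_eq_refl _).inter Ico_ae_eq_Ioc.symm)]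
    exact (congrArg volume hinter).trans Real.volume_Icc
  rw [AddCircle.volume_eq_smul_haarAddCircle, Measure.smul_apply, smul_eq_mul] at hvol
  have hreal := congrArg ENNReal.toReal hvol
  rw [ENNReal.toReal_mul, ENNReal.toReal_ofReal hP.out.le,
    ENNReal.toReal_ofReal (sub_nonneg.2 hxy)] at hreal
  rw [measureReal_def, eq_div_iff hP.out.ne', mul_comm, hreal]

theorem haarAddCircle_frontier_coe_image_Icc :
    AddCircle.haarAddCircle (frontier (((↑) : ℝ → AddCircle P) '' Icc x y)) = 0 := by
  have : Nontrivial (Ico (0 : ℝ) (0 + P)) :=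
    (Ico_infinite (lt_add_of_pos_right 0 hP.out)).nontrivial.coe_sort
  have : Nontrivial (AddCircle P) := (AddCircle.equivIco P 0).symm.injective.nontrivial
  exact (((finite_singleton _).insert _).subset frontier_coe_image_Icc_subset).measure_zero _

end Weyl

theorem Tile.fourier_angle (T : Tile ι) (k : ℤ) :
    fourier k (T.angle : AddCircle (2 * Real.pi)) = T.direction ^ k := by
  rw [fourier_coe_apply, ← T.exp_angle_mul_I, ← Complex.exp_int_mul]
  congr 1
  push_cast
  field_simp [Real.pi_ne_zero]

theorem uniformlyDistributedAlong_of_isLittleO_sum_direction_zpow {N : Set ℕ} {s : ℕ → Tile ι}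
    (h : ∀ k : ℤ, k ≠ 0 → (fun n => ∑ j ∈ Finset.range n, (s j).direction ^ k)
      =o[atTop ⊓ 𝓟 N] fun n => (n : ℝ)) : UniformlyDistributedAlong N s := by
  intro x y hx hxy hy
  have : Fact (0 < 2 * Real.pi) := ⟨Real.two_pi_pos⟩
  have hfreq := tendsto_frequency_of_isLittleO_sum_fourier inf_le_left
    (x := fun j => ((s j).angle : AddCircle (2 * Real.pi)))
    (by simpa only [Tile.fourier_angle] using h)
    (isClosed_coe_image_Icc (x := x) (y := y)).measurableSet haarAddCircle_frontier_coe_image_Icc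
  unfold angleFrequency
  simpa only [coe_mem_image_Icc_iff hx hy (s _).angle_mem_Ico,
    haarAddCircle_real_coe_image_Icc hx hxy.le hy] using hfreq

theorem Substitution.IsSelfSimilar.hasStatisticalCircularSymmetry [Fintype ι] [DecidableEq ι]
    {σ : Substitution ι} (hσ : σ.IsSelfSimilar) (hprim : σ.matrix.IsPrimitive)
    {𝒯 : Set (Tile ι)} (h𝒯 : 𝒯 ∈ σ.tilingSpace) (hpin : IsPinwheelLike 𝒯)
    {𝒯' : Set (Tile ι)} (h𝒯' : 𝒯' ∈ σ.tilingSpace) : σ.HasStatisticalCircularSymmetry 𝒯' := by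
  obtain ⟨p, hp0, hp⟩ := exists_hasAllKinds σ hprim
  have hmeans (k : ℤ) (hk : k ≠ 0) : σ.HasSmallSupertileMeans fun T => T.direction ^ k :=
    hσ.hasSmallSupertileMeans_direction_zpow hp h𝒯 hpin hk
  constructor
  · exact fun s hs => uniformlyDistributedAlong_of_isLittleO_sum_direction_zpow fun k hk =>
      hσ.isLittleO_sum_range_along_supertiles (hmeans k hk) (injOn_univ.1 hs.1.injOn)
  · refine fun s hs => uniformlyDistributedAlong_of_isLittleO_sum_direction_zpow fun k hk => ?_
    rw [principal_univ, inf_top_eq]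
    exact hσ.isLittleO_sum_range_by_distance hp hp0 h𝒯' (by simp [Tile.norm_direction])
      (hmeans k hk) hs

end PlaneTiling

end

theorem theorem6p1 {ι : Type*} [Fintype ι] [DecidableEq ι] (σ : PlaneTiling.Substitution ι)
    (hself : σ.IsSelfSimilar) (hprim : σ.matrix.IsPrimitive)
    (𝒯 : Set (PlaneTiling.Tile ι)) (h𝒯 : 𝒯 ∈ σ.tilingSpace)
    (hpin : PlaneTiling.IsPinwheelLike 𝒯) :
    σ.HasStatisticalCircularSymmetry 𝒯 ∧
      ∀ 𝒯' ∈ σ.tilingSpace, σ.HasStatisticalCircularSymmetry 𝒯' :=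
  ⟨hself.hasStatisticalCircularSymmetry hprim h𝒯 hpin h𝒯,
    fun _ h𝒯' => hself.hasStatisticalCircularSymmetry hprim h𝒯 hpin h𝒯'⟩
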